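/- Let $M$ be a smooth $m$-dimensional manifold and let $\pi:Q\to\mathbb R$ be a smooth fibre bundle with typical fibre $M$ over the time axis $\mathbb R$ with its Cartesian coordinate $t$ (manifolds are Hausdorff and second countable, smooth means $C^\infty$). Bundle coordinates on $Q$ are local coordinates $(q^\lambda)=(q^0=t,q^1,\dots,q^m)$ with $t=\pi$; Greek indices run over $0,\dots,m$, Latin ones over $1,\dots,m$, and repeated indices are summed. Identify the first order jet manifold $J^1Q$, with coordinates $(t,q^i,q^i_t)$, with the submanifold $\dot t=1$, $\dot q^i=q^i_t$ of $TQ$. A dynamic equation on $Q$ is a holonomic connection $$\xi=\partial_t+q^i_t\,\partial_i+\xi^i(t,q^j,q^j_t)\,\partial^t_i$$ on $J^1Q\to\mathbb R$, i.e. a second order equation $q^i_{tt}=\xi^i(t,q^j,q^j_t)$. A reference frame is a connection on $Q\to\mathbb R$, i.e. a smooth vector field $\Gamma$ on $Q$ with $dt(\Gamma)=1$; bundle coordinates $(t,\overline q^i)$ are proper for $\Gamma$ if $\Gamma=\partial_t$ in them. The dynamic equation $\xi$ is called a free motion equation if there are a reference frame $\Gamma$ and an atlas of bundle coordinates $(t,\overline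 q^i)$ proper for $\Gamma$ in which the equation reads $\overline q^i_{tt}=0$. If $\xi$ is a free motion equation on $Q$, then: 1. $\xi$ is quadratic: in all bundle coordinates, $$\xi^i=a^i_{jk}(q^\mu)\,q^j_tq^k_t+b^i_j(q^\mu)\,q^j_t+f^i(q^\mu)$$ with smooth functions $a^i_{jk}=a^i_{kj}$, $b^i_j$, $f^i$; 2. there is a unique linear connection $K=dq^\lambda\otimes(\partial_\lambda+K_\lambda{}^\mu{}_\nu\,\dot q^\nu\,\dot\partial_\mu)$ on $TQ\to Q$ which in all bundle coordinates has the components $$K_\lambda{}^0{}_\nu=0,\qquad K_0{}^i{}_0=f^i,\qquad K_0{}^i{}_j=K_j{}^i{}_0=\tfrac12 b^i_j,\qquad K_k{}^i{}_j=a^i_{kj},$$ and this connection is smooth, symmetric (torsion-free) and curvature-free. -/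

import Mathlib

open scoped Manifold ContDiff Topology

noncomputable section

namespace TimeMechanics

section Bundle

variable {m : ℕ} {Q : Type*} [TopologicalSpace Q] [ChartedSpace (EuclideanSpace ℝ (Fin (m + 1))) Q]

/-- `π : Q → ℝ` is a smooth fibre bundle over the time axis with typical fibre `M`: the projection
is smooth, and around every instant there is a local trivialization
`π⁻¹(U) ≅ U × M` over `U` which is a diffeomorphism. -/
structure IsSmoothFibreBundle (m : ℕ) {Q : Type*} [TopologicalSpace Q]
    [ChartedSpace (EuclideanSpace ℝ (Fin (m + 1))) Q] (M : Type*) [TopologicalSpace M]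
    [ChartedSpace (EuclideanSpace ℝ (Fin m)) M] (π : Q → ℝ) : Prop where
  contMDiff_proj : ContMDiff (𝓡 (m + 1)) 𝓘(ℝ, ℝ) ∞ π
  exists_trivialization : ∀ t : ℝ, ∃ e : Bundle.Trivialization M π, t ∈ e.baseSet ∧
    ContMDiffOn (𝓡 (m + 1)) (𝓘(ℝ, ℝ).prod (𝓡 m)) ∞ e e.source ∧
    ContMDiffOn (𝓘(ℝ, ℝ).prod (𝓡 m)) (𝓡 (m + 1)) ∞ e.toOpenPartialHomeomorph.symm e.target

/-- Bundle coordinates `(t, q¹, …, qᵐ)` on `π : Q → ℝ`: a smooth chart of `Q` whose zeroth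
coordinate is the time `t = π`. -/
structure IsBundleChart (π : Q → ℝ)
    (φ : OpenPartialHomeomorph Q (EuclideanSpace ℝ (Fin (m + 1)))) : Prop where
  mem_maximalAtlas : φ ∈ IsManifold.maximalAtlas (𝓡 (m + 1)) ∞ Q
  time_coord : ∀ q ∈ φ.source, φ q 0 = π q

/-- The induced fibre coordinates `(q̇⁰, …, q̇ᵐ)` of a tangent vector `v` at `q`, with respect to
the coordinates `φ` on `Q`; here `q̇⁰ = ṫ` if `φ` is a bundle chart. -/
def velocity (φ : OpenPartialHomeomorph Q (EuclideanSpace ℝ (Fin (m + 1)))) (q : Q)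
    (v : TangentSpace (𝓡 (m + 1)) q) : EuclideanSpace ℝ (Fin (m + 1)) :=
  mfderiv (𝓡 (m + 1)) 𝓘(ℝ, EuclideanSpace ℝ (Fin (m + 1))) φ q v

/-- The function `ṫ = dt` on the tangent bundle `TQ`. -/
def timeRate (π : Q → ℝ) (v : TangentBundle (𝓡 (m + 1)) Q) : ℝ :=
  mfderiv (𝓡 (m + 1)) 𝓘(ℝ, ℝ) π v.proj v.2

/-- The first order jet manifold `J¹Q` of `π : Q → ℝ`, identified with its image under the canonical
imbedding `(t, qⁱ, qⁱₜ) ↦ (t, qⁱ, ṫ = 1, q̇ⁱ = qⁱₜ)` in `TQ`. -/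
def jetOne (π : Q → ℝ) : Set (TangentBundle (𝓡 (m + 1)) Q) :=
  {v | timeRate π v = 1}

end Bundle

section Equation

variable {m : ℕ} {Q : Type*} [TopologicalSpace Q] [ChartedSpace (EuclideanSpace ℝ (Fin (m + 1))) Q]
  [IsManifold (𝓡 (m + 1)) ∞ Q]

/-- A dynamic equation on `π : Q → ℝ`: a holonomic connection
`ξ = ∂ₜ + qⁱₜ ∂ᵢ + ξⁱ(t, q, qₜ) ∂ᵢᵗ` on `J¹Q → ℝ`, that is, a smooth vector field on `J¹Q ⊆ TQ` (the
field `tangent` says that it is tangent to the submanifold `ṫ = 1`) with values in `J²Q`, which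
means that it projects at `v ∈ J¹Q` to `v` itself. The values of `toFun` off `J¹Q` are
irrelevant. -/
structure DynamicEquation (m : ℕ) {Q : Type*} [TopologicalSpace Q]
    [ChartedSpace (EuclideanSpace ℝ (Fin (m + 1))) Q] [IsManifold (𝓡 (m + 1)) ∞ Q]
    (π : Q → ℝ) where
  toFun : ∀ v : TangentBundle (𝓡 (m + 1)) Q, TangentSpace (𝓡 (m + 1)).tangent v
  holonomic : ∀ v ∈ jetOne π,
    mfderiv (𝓡 (m + 1)).tangent (𝓡 (m + 1))
      (fun w : TangentBundle (𝓡 (m + 1)) Q => w.proj) v (toFun v) = v.2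
  tangent : ∀ v ∈ jetOne π,
    mfderiv (𝓡 (m + 1)).tangent 𝓘(ℝ, ℝ) (timeRate π) v (toFun v) = 0
  smooth : ContMDiffOn (𝓡 (m + 1)).tangent (𝓡 (m + 1)).tangent.tangent ∞
    (fun v => (⟨v, toFun v⟩ :
      TangentBundle (𝓡 (m + 1)).tangent (TangentBundle (𝓡 (m + 1)) Q))) (jetOne π)

/-- The component `ξⁱ` at `v ∈ J¹Q` of a dynamic equation in the bundle coordinates `φ`: the derivative
of the function `q̇ⁱ` on `TQ` along `ξ`. The equation reads `qⁱₜₜ = ξⁱ(t, q, qₜ)`. -/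
def DynamicEquation.component {π : Q → ℝ} (ξ : DynamicEquation m π)
    (φ : OpenPartialHomeomorph Q (EuclideanSpace ℝ (Fin (m + 1))))
    (v : TangentBundle (𝓡 (m + 1)) Q) (i : Fin m) : ℝ :=
  (show EuclideanSpace ℝ (Fin (m + 1)) from
    mfderiv (𝓡 (m + 1)).tangent 𝓘(ℝ, EuclideanSpace ℝ (Fin (m + 1)))
      (fun w : TangentBundle (𝓡 (m + 1)) Q => velocity φ w.proj w.2) v (ξ.toFun v)) i.succ

/-- A reference frame on `π : Q → ℝ`: a connection `Γ` on this bundle, that is, a smooth vector field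
`Γ` on `Q` with `dt(Γ) = 1`. -/
structure ReferenceFrame (m : ℕ) {Q : Type*} [TopologicalSpace Q]
    [ChartedSpace (EuclideanSpace ℝ (Fin (m + 1))) Q] [IsManifold (𝓡 (m + 1)) ∞ Q]
    (π : Q → ℝ) where
  toFun : ∀ q : Q, TangentSpace (𝓡 (m + 1)) q
  smooth : ContMDiff (𝓡 (m + 1)) (𝓡 (m + 1)).tangent ∞
    (fun q => (⟨q, toFun q⟩ : TangentBundle (𝓡 (m + 1)) Q))
  time_rate : ∀ q : Q, timeRate π ⟨q, toFun q⟩ = 1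

/-- The bundle coordinates `φ` are proper for the reference frame `Γ`: in them `Γ = ∂ₜ`. -/
def ReferenceFrame.IsProperChart {π : Q → ℝ} (Γ : ReferenceFrame m π)
    (φ : OpenPartialHomeomorph Q (EuclideanSpace ℝ (Fin (m + 1)))) : Prop :=
  IsBundleChart π φ ∧
    ∀ q ∈ φ.source, velocity φ q (Γ.toFun q) = EuclideanSpace.single 0 1

/-- `ξ` is a free motion equation: there are a reference frame and an atlas of bundle coordinates
`(t, q̄ⁱ)` proper for it, with respect to all of which the equation reads `q̄ⁱₜₜ = 0`. -/
def DynamicEquation.IsFreeMotion {π : Q → ℝ} (ξ : DynamicEquation m π) : Prop :=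
  ∃ Γ : ReferenceFrame m π, ∀ q : Q,
    ∃ φ : OpenPartialHomeomorph Q (EuclideanSpace ℝ (Fin (m + 1))),
      q ∈ φ.source ∧ Γ.IsProperChart φ ∧
      ∀ v ∈ jetOne π, v.proj ∈ φ.source → ∀ i, ξ.component φ v i = 0

/-- In the bundle coordinates `φ` the equation is quadratic with smooth coefficient functions
`a i j k = a k j` (symmetric), `b i j` and `f i`:
`ξⁱ = aⁱⱼₖ(q) qʲₜ qᵏₜ + bⁱⱼ(q) qʲₜ + fⁱ(q)`. -/
structure DynamicEquation.HasQuadraticForm {π : Q → ℝ} (ξ : DynamicEquation m π)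
    (φ : OpenPartialHomeomorph Q (EuclideanSpace ℝ (Fin (m + 1))))
    (a : Fin m → Fin m → Fin m → Q → ℝ) (b : Fin m → Fin m → Q → ℝ) (f : Fin m → Q → ℝ) :
    Prop where
  symm : ∀ i j k, ∀ q ∈ φ.source, a i j k q = a i k j q
  smooth_a : ∀ i j k, ContMDiffOn (𝓡 (m + 1)) 𝓘(ℝ, ℝ) ∞ (a i j k) φ.source
  smooth_b : ∀ i j, ContMDiffOn (𝓡 (m + 1)) 𝓘(ℝ, ℝ) ∞ (b i j) φ.source
  smooth_f : ∀ i, ContMDiffOn (𝓡 (m + 1)) 𝓘(ℝ, ℝ) ∞ (f i) φ.source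
  component_eq : ∀ v ∈ jetOne π, v.proj ∈ φ.source → ∀ i, ξ.component φ v i =
    (∑ j, ∑ k, a i j k v.proj * velocity φ v.proj v.2 j.succ * velocity φ v.proj v.2 k.succ) +
      (∑ j, b i j v.proj * velocity φ v.proj v.2 j.succ) + f i v.proj

/-- `ξ` is a quadratic dynamic equation: it is quadratic in the velocities in all bundle
coordinates. -/
def DynamicEquation.IsQuadratic {π : Q → ℝ} (ξ : DynamicEquation m π) : Prop :=
  ∀ φ, IsBundleChart π φ → ∃ a b f, ξ.HasQuadraticForm φ a b f

end Equation

section Connection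

variable {m : ℕ} {Q : Type*} [TopologicalSpace Q] [ChartedSpace (EuclideanSpace ℝ (Fin (m + 1))) Q]
  [IsManifold (𝓡 (m + 1)) ∞ Q]

/-- A linear connection on the vector bundle `TQ → Q`, given by its covariant derivative: `K Z q v` is
`∇_v Z` at `q`. -/
abbrev LinearConnection (m : ℕ) (Q : Type*) [TopologicalSpace Q]
    [ChartedSpace (EuclideanSpace ℝ (Fin (m + 1))) Q] [IsManifold (𝓡 (m + 1)) ∞ Q] :=
  CovariantDerivative (𝓡 (m + 1)) (EuclideanSpace ℝ (Fin (m + 1)))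
    (TangentSpace (𝓡 (m + 1)) : Q → Type _)

/-- The linear connection `K = dq^λ ⊗ (∂_λ + K_λ^μ_ν q̇^ν ∂̇_μ)` has the components
`k l μ ν = K_l^μ_ν` in the coordinates `φ`. In terms of the covariant derivative,
`(∇_v Z)^μ = v(Z^μ) - K_l^μ_ν v^l Z^ν` for all vector fields `Z` differentiable at the point. -/
def LinearConnection.HasComponents (K : LinearConnection m Q)
    (φ : OpenPartialHomeomorph Q (EuclideanSpace ℝ (Fin (m + 1))))
    (k : Fin (m + 1) → Fin (m + 1) → Fin (m + 1) → Q → ℝ) : Prop :=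
  ∀ q ∈ φ.source, ∀ Z : ∀ p : Q, TangentSpace (𝓡 (m + 1)) p,
    MDifferentiableAt (𝓡 (m + 1)) (𝓡 (m + 1)).tangent
      (fun p => (⟨p, Z p⟩ : TangentBundle (𝓡 (m + 1)) Q)) q →
    ∀ (v : TangentSpace (𝓡 (m + 1)) q) (μ : Fin (m + 1)),
      velocity φ q (K Z q v) μ =
        (show ℝ from mfderiv (𝓡 (m + 1)) 𝓘(ℝ, ℝ) (fun p => velocity φ p (Z p) μ) q v) -
          ∑ l, ∑ ν, k l μ ν q * velocity φ q v l * velocity φ q (Z q) ν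

/-- The components `K_l^0_ν = 0`, `K_0^i_0 = fⁱ`, `K_0^i_j = K_j^i_0 = ½ bⁱⱼ`, `K_k^i_j = aⁱₖⱼ`
built from the coefficients of a quadratic equation. -/
def quadraticComponents (a : Fin m → Fin m → Fin m → Q → ℝ) (b : Fin m → Fin m → Q → ℝ)
    (f : Fin m → Q → ℝ) (l μ ν : Fin (m + 1)) (q : Q) : ℝ :=
  Fin.cases 0
    (fun i => Fin.cases
      (Fin.cases (f i q) (fun j => (1 / 2) * b i j q) ν)
      (fun k => Fin.cases ((1 / 2) * b i k q) (fun j => a i k j q) ν) l) μ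

/-- `K` is the linear connection on `TQ → Q` corresponding to the quadratic dynamic equation `ξ`. -/
def LinearConnection.CorrespondsTo (K : LinearConnection m Q) {π : Q → ℝ}
    (ξ : DynamicEquation m π) : Prop :=
  ∀ φ, IsBundleChart π φ → ∃ a b f, ξ.HasQuadraticForm φ a b f ∧
    K.HasComponents φ (quadraticComponents a b f)

/-- The curvature `R(X, Y) Z = ∇_X ∇_Y Z - ∇_Y ∇_X Z - ∇_[X, Y] Z` at `q`. -/
def LinearConnection.curvature (K : LinearConnection m Q)
    (X Y Z : ∀ p : Q, TangentSpace (𝓡 (m + 1)) p) (q : Q) : TangentSpace (𝓡 (m + 1)) q :=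
  K (fun p => K Z p (Y p)) q (X q) - K (fun p => K Z p (X p)) q (Y q) -
    K Z q (VectorField.mlieBracket (𝓡 (m + 1)) X Y q)

/-- The connection is curvature-free: `R(X, Y) Z = 0` at every point `q` for all vector fields that are
smooth at `q`. -/
def LinearConnection.IsCurvatureFree (K : LinearConnection m Q) : Prop :=
  ∀ (q : Q) (X Y Z : ∀ p : Q, TangentSpace (𝓡 (m + 1)) p),
    ContMDiffAt (𝓡 (m + 1)) (𝓡 (m + 1)).tangent ∞
      (fun p => (⟨p, X p⟩ : TangentBundle (𝓡 (m + 1)) Q)) q →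
    ContMDiffAt (𝓡 (m + 1)) (𝓡 (m + 1)).tangent ∞
      (fun p => (⟨p, Y p⟩ : TangentBundle (𝓡 (m + 1)) Q)) q →
    ContMDiffAt (𝓡 (m + 1)) (𝓡 (m + 1)).tangent ∞
      (fun p => (⟨p, Z p⟩ : TangentBundle (𝓡 (m + 1)) Q)) q →
    K.curvature X Y Z q = 0

/-- Two covariant derivatives represent the same linear connection: they agree on every
vector field at every point where the field is differentiable (elsewhere a covariant derivative takes
arbitrary values). -/
def LinearConnection.SameAs (K K' : LinearConnection m Q) : Prop :=
  ∀ (q : Q) (Z : ∀ p : Q, TangentSpace (𝓡 (m + 1)) p),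
    MDifferentiableAt (𝓡 (m + 1)) (𝓡 (m + 1)).tangent
      (fun p => (⟨p, Z p⟩ : TangentBundle (𝓡 (m + 1)) Q)) q →
    K Z q = K' Z q

end Connection

end TimeMechanics

end

noncomputable section

set_option linter.unusedSectionVars false

/-! Call a bundle chart free if the equation has zero acceleration in it. Under a coordinate change
`T`, the acceleration of a velocity `u` becomes `T''(u, u)` plus the image under `T'` of the old
acceleration (`DynamicEquation.acceleration_transition`). Between two free charts this leaves
`T''(u, u) = 0` whenever `u⁰ = 1`. A symmetric bilinear map vanishing on the diagonal of that
hyperplane is zero (`eq_zero_of_symm_of_diag_eq_zero`), so `T'' = 0`. Differentiating the components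
of a vector field therefore gives the same result in every free chart, and these derivatives glue to
`flatConnection`.

In an arbitrary bundle chart both the acceleration and the connection are governed by the single
bilinear map `-(T')⁻¹ T''` (`flatCoefficients`), where `T` goes to a free chart. Its diagonal at `u⁰
= 1` is the acceleration, which is hence quadratic in the remaining velocities; its matrix entries
are the components of the connection. The time row vanishes by polarization, since the equation is
tangent to `ṫ = 1`.

A corresponding connection has zero components in free charts, because there the quadratic form is
identically zero; this gives uniqueness. Torsion and curvature vanish because in a free chart the
covariant derivative is the ordinary one: the first claim becomes the coordinate formula for the Lie
bracket, the second the symmetry of second derivatives. -/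

namespace TimeMechanics

/-! ### Fibre coordinates and their first and second order transformation laws -/

section Charts

variable {m : ℕ} {Q : Type*} [TopologicalSpace Q] [ChartedSpace (EuclideanSpace ℝ (Fin (m + 1))) Q]
  [IsManifold (𝓡 (m + 1)) ∞ Q]
  {φ ψ : OpenPartialHomeomorph Q (EuclideanSpace ℝ (Fin (m + 1)))}

/-- The model space of a manifold of dimension `m + 1`. -/
abbrev Coord (m : ℕ) := EuclideanSpace ℝ (Fin (m + 1))

/-- The coordinate change from `φ` to `ψ`. -/
abbrev transition (φ ψ : OpenPartialHomeomorph Q (Coord m)) : Coord m → Coord m := ψ ∘ φ.symm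

theorem mdifferentiable_of_mem_maximalAtlas (hφ : φ ∈ IsManifold.maximalAtlas (𝓡 (m + 1)) ∞ Q) :
    φ.MDifferentiable (𝓡 (m + 1)) (𝓡 (m + 1)) :=
  ⟨(contMDiffOn_of_mem_maximalAtlas hφ).mdifferentiableOn (by simp),
    (contMDiffOn_symm_of_mem_maximalAtlas hφ).mdifferentiableOn (by simp)⟩

/-- The fibre coordinates of tangent vectors at `q` as a linear isomorphism. -/
def velocityEquiv (hφ : φ ∈ IsManifold.maximalAtlas (𝓡 (m + 1)) ∞ Q) {q : Q} (hq : q ∈ φ.source) :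
    TangentSpace (𝓡 (m + 1)) q ≃L[ℝ] Coord m :=
  (mdifferentiable_of_mem_maximalAtlas hφ).mfderiv hq

@[simp]
theorem velocityEquiv_apply (hφ : φ ∈ IsManifold.maximalAtlas (𝓡 (m + 1)) ∞ Q) {q : Q}
    (hq : q ∈ φ.source) (v : TangentSpace (𝓡 (m + 1)) q) :
    velocityEquiv hφ hq v = velocity φ q v := rfl

theorem velocity_injective (hφ : φ ∈ IsManifold.maximalAtlas (𝓡 (m + 1)) ∞ Q) {q : Q}
    (hq : q ∈ φ.source) : Function.Injective (velocity φ q) :=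
  (velocityEquiv hφ hq).injective

theorem velocity_surjective (hφ : φ ∈ IsManifold.maximalAtlas (𝓡 (m + 1)) ∞ Q) {q : Q}
    (hq : q ∈ φ.source) : Function.Surjective (velocity φ q) :=
  (velocityEquiv hφ hq).surjective

theorem contDiffAt_comp_symm {F : Type*} [NormedAddCommGroup F] [NormedSpace ℝ F] {ζ : Q → F}
    (hφ : φ ∈ IsManifold.maximalAtlas (𝓡 (m + 1)) ∞ Q) {q : Q} (hq : q ∈ φ.source)
    (hζ : ContMDiffAt (𝓡 (m + 1)) 𝓘(ℝ, F) ∞ ζ q) : ContDiffAt ℝ ∞ (ζ ∘ φ.symm) (φ q) := by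
  rw [← contMDiffAt_iff_contDiffAt]
  refine ContMDiffAt.comp (I' := 𝓡 (m + 1)) (φ q) ?_
    (contMDiffAt_symm_of_mem_maximalAtlas hφ (φ.map_source hq))
  rwa [φ.left_inv hq]

theorem mfderiv_eq_fderiv_comp_symm {F : Type*} [NormedAddCommGroup F] [NormedSpace ℝ F]
    {ζ : Q → F} (hφ : φ ∈ IsManifold.maximalAtlas (𝓡 (m + 1)) ∞ Q) {q : Q} (hq : q ∈ φ.source)
    (hζ : MDifferentiableAt (𝓡 (m + 1)) 𝓘(ℝ, F) ζ q) (v : TangentSpace (𝓡 (m + 1)) q) :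
    mfderiv (𝓡 (m + 1)) 𝓘(ℝ, F) ζ q v = fderiv ℝ (ζ ∘ φ.symm) (φ q) (velocity φ q v) := by
  have hm := mdifferentiable_of_mem_maximalAtlas hφ
  have h1 : HasMFDerivAt (𝓡 (m + 1)) (𝓡 (m + 1)) φ q (mfderiv (𝓡 (m + 1)) (𝓡 (m + 1)) φ q) :=
    (hm.mdifferentiableAt hq).hasMFDerivAt
  have hd : MDifferentiableAt (𝓡 (m + 1)) 𝓘(ℝ, F) (ζ ∘ φ.symm) (φ q) := by
    refine MDifferentiableAt.comp (I' := 𝓡 (m + 1)) (φ q) ?_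
      (hm.mdifferentiableAt_symm (φ.map_source hq))
    rwa [φ.left_inv hq]
  have h2 : HasMFDerivAt (𝓡 (m + 1)) 𝓘(ℝ, F) (ζ ∘ φ.symm) (φ q)
      (fderiv ℝ (ζ ∘ φ.symm) (φ q)) :=
    hd.differentiableAt.hasFDerivAt.hasMFDerivAt
  have h3 := (h2.comp q h1).congr_of_eventuallyEq (f₁ := ζ) (by
    filter_upwards [φ.open_source.mem_nhds hq] with p hp
    simp [φ.left_inv hp])
  exact congrArg (fun L : TangentSpace (𝓡 (m + 1)) q →L[ℝ] F => L v) h3.mfderiv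

theorem contDiffAt_transition (hφ : φ ∈ IsManifold.maximalAtlas (𝓡 (m + 1)) ∞ Q)
    (hψ : ψ ∈ IsManifold.maximalAtlas (𝓡 (m + 1)) ∞ Q) {q : Q} (hqφ : q ∈ φ.source)
    (hqψ : q ∈ ψ.source) : ContDiffAt ℝ ∞ (transition φ ψ) (φ q) :=
  contDiffAt_comp_symm hφ hqφ (contMDiffAt_of_mem_maximalAtlas hψ hqψ)

theorem velocity_transition (hφ : φ ∈ IsManifold.maximalAtlas (𝓡 (m + 1)) ∞ Q)
    (hψ : ψ ∈ IsManifold.maximalAtlas (𝓡 (m + 1)) ∞ Q) {q : Q} (hqφ : q ∈ φ.source)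
    (hqψ : q ∈ ψ.source) (v : TangentSpace (𝓡 (m + 1)) q) :
    velocity ψ q v = fderiv ℝ (transition φ ψ) (φ q) (velocity φ q v) :=
  mfderiv_eq_fderiv_comp_symm hφ hqφ
    ((mdifferentiable_of_mem_maximalAtlas hψ).mdifferentiableAt hqψ) v

theorem fderiv_transition_comp (hφ : φ ∈ IsManifold.maximalAtlas (𝓡 (m + 1)) ∞ Q)
    (hψ : ψ ∈ IsManifold.maximalAtlas (𝓡 (m + 1)) ∞ Q) {q : Q} (hqφ : q ∈ φ.source)
    (hqψ : q ∈ ψ.source) (u : Coord m) :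
    fderiv ℝ (transition ψ φ) (ψ q) (fderiv ℝ (transition φ ψ) (φ q) u) = u := by
  obtain ⟨v, rfl⟩ := velocity_surjective hφ hqφ u
  rw [← velocity_transition hφ hψ hqφ hqψ, ← velocity_transition hψ hφ hqψ hqφ]

/-- The fibre coordinates are the second component of the tangent map of `φ`, which is smooth over
the source. -/
theorem contMDiffAt_velocity (hφ : φ ∈ IsManifold.maximalAtlas (𝓡 (m + 1)) ∞ Q)
    {v : TangentBundle (𝓡 (m + 1)) Q} (hv : v.proj ∈ φ.source) :
    ContMDiffAt (𝓡 (m + 1)).tangent 𝓘(ℝ, Coord m) ∞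
      (fun w : TangentBundle (𝓡 (m + 1)) Q => velocity φ w.proj w.2) v := by
  have h := (contMDiffOn_of_mem_maximalAtlas hφ).contMDiffOn_tangentMapWithin (m := ∞) (by simp)
    φ.open_source.uniqueMDiffOn
  have hopen : Bundle.TotalSpace.proj ⁻¹' φ.source ∈ 𝓝 v :=
    (FiberBundle.continuous_proj (Coord m) (TangentSpace (𝓡 (m + 1)))).continuousAt.preimage_mem_nhds
      (φ.open_source.mem_nhds hv)
  have h1 := (contMDiff_snd_tangentBundle_modelSpace (Coord m) (𝓡 (m + 1))
    (n := ∞)).contMDiffAt.comp v (h.contMDiffAt hopen)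
  refine h1.congr_of_eventuallyEq ?_
  filter_upwards [hopen] with w hw
  simp only [Function.comp, tangentMapWithin]
  rw [mfderivWithin_of_isOpen φ.open_source hw]
  rfl

variable {E' : Type*} [NormedAddCommGroup E'] [NormedSpace ℝ E'] {H' : Type*} [TopologicalSpace H']
  {J : ModelWithCorners ℝ E' H'} {N : Type*} [TopologicalSpace N] [ChartedSpace H' N]
  {g : N → TangentBundle (𝓡 (m + 1)) Q} {n : N}

theorem mdifferentiableAt_velocity_comp (hφ : φ ∈ IsManifold.maximalAtlas (𝓡 (m + 1)) ∞ Q)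
    (hg : MDifferentiableAt J (𝓡 (m + 1)).tangent g n) (hn : (g n).proj ∈ φ.source) :
    MDifferentiableAt J 𝓘(ℝ, Coord m) (fun x => velocity φ (g x).proj (g x).2) n :=
  ((contMDiffAt_velocity hφ hn).mdifferentiableAt (by simp)).comp n hg

theorem mdifferentiableAt_proj_comp (hg : MDifferentiableAt J (𝓡 (m + 1)).tangent g n) :
    MDifferentiableAt J (𝓡 (m + 1)) (fun x => (g x).proj) n :=
  ((Bundle.contMDiff_proj (TangentSpace (𝓡 (m + 1))) (n := 1)).contMDiffAt.mdifferentiableAt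
    (by simp)).comp n hg

theorem hasMFDerivAt_clm_apply {F G : Type*} [NormedAddCommGroup F] [NormedSpace ℝ F]
    [NormedAddCommGroup G] [NormedSpace ℝ G] {A : N → F →L[ℝ] G} {f : N → F}
    {A' : E' →L[ℝ] F →L[ℝ] G} {f' : E' →L[ℝ] F}
    (hA : HasMFDerivAt J 𝓘(ℝ, F →L[ℝ] G) A n A') (hf : HasMFDerivAt J 𝓘(ℝ, F) f n f') :
    HasMFDerivAt J 𝓘(ℝ, G) (fun x => A x (f x)) n ((A n).comp f' + A'.flip (f n)) := by
  refine ⟨hA.1.clm_apply hf.1, ?_⟩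
  have h := hA.2.clm_apply hf.2
  simp only [writtenInExtChartAt, extChartAt_model_space_eq_id, PartialEquiv.refl_coe,
    Function.comp_apply, id_eq, extChartAt_to_inv] at h
  exact h

theorem hasMFDerivAt_smul {F : Type*} [NormedAddCommGroup F] [NormedSpace ℝ F] {c : N → ℝ}
    {f : N → F} {c' : E' →L[ℝ] ℝ} {f' : E' →L[ℝ] F} (hc : HasMFDerivAt J 𝓘(ℝ, ℝ) c n c')
    (hf : HasMFDerivAt J 𝓘(ℝ, F) f n f') :
    HasMFDerivAt J 𝓘(ℝ, F) (fun x => c x • f x) n (c n • f' + c'.smulRight (f n)) := by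
  refine ⟨hc.1.smul hf.1, ?_⟩
  have h := hc.2.smul hf.2
  simp only [writtenInExtChartAt, extChartAt_model_space_eq_id, PartialEquiv.refl_coe,
    Function.comp_apply, id_eq, extChartAt_to_inv] at h
  exact h

/-- The derivative of `x ↦ T'(φ) (q̇)` along a curve of tangent vectors. -/
theorem mfderiv_fderiv_velocity {F : Type*} [NormedAddCommGroup F] [NormedSpace ℝ F]
    {T : Coord m → F} (hφ : φ ∈ IsManifold.maximalAtlas (𝓡 (m + 1)) ∞ Q)
    (hg : MDifferentiableAt J (𝓡 (m + 1)).tangent g n) (hn : (g n).proj ∈ φ.source)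
    (hT : ContDiffAt ℝ ∞ T (φ (g n).proj)) (ζ : TangentSpace J n) :
    mfderiv J 𝓘(ℝ, F)
        (fun x => fderiv ℝ T (φ (g x).proj) (velocity φ (g x).proj (g x).2)) n ζ =
      fderiv ℝ (fderiv ℝ T) (φ (g n).proj)
          (velocity φ (g n).proj (mfderiv J (𝓡 (m + 1)) (fun x => (g x).proj) n ζ))
          (velocity φ (g n).proj (g n).2) +
        fderiv ℝ T (φ (g n).proj)
          (mfderiv J 𝓘(ℝ, Coord m) (fun x => velocity φ (g x).proj (g x).2) n ζ) := by
  have h1 : HasMFDerivAt J 𝓘(ℝ, Coord m) (fun x => φ (g x).proj) n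
      ((mfderiv (𝓡 (m + 1)) (𝓡 (m + 1)) φ (g n).proj).comp
        (mfderiv J (𝓡 (m + 1)) (fun x => (g x).proj) n)) :=
    (((mdifferentiable_of_mem_maximalAtlas hφ).mdifferentiableAt hn).hasMFDerivAt).comp n
      (mdifferentiableAt_proj_comp hg).hasMFDerivAt
  have h2 : HasFDerivAt (fderiv ℝ T) (fderiv ℝ (fderiv ℝ T) (φ (g n).proj)) (φ (g n).proj) :=
    ((hT.fderiv_right (m := 1) (by norm_cast)).differentiableAt (by simp)).hasFDerivAt
  have h3 : HasMFDerivAt J 𝓘(ℝ, Coord m →L[ℝ] F)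
      (fun x => fderiv ℝ T (φ (g x).proj)) n _ := h2.hasMFDerivAt.comp n h1
  have h4 := (mdifferentiableAt_velocity_comp hφ hg hn).hasMFDerivAt
  rw [(hasMFDerivAt_clm_apply h3 h4).mfderiv]
  exact add_comm _ _

/-- Product rule applied to `q̇' = T'(q) q̇`. The source `N` is kept general because two cases are
needed: `g` the identity of `TQ`, for dynamic equations, and `g` a vector field on `Q`, for
covariant derivatives. -/
theorem mfderiv_velocity_transition (hφ : φ ∈ IsManifold.maximalAtlas (𝓡 (m + 1)) ∞ Q)
    (hψ : ψ ∈ IsManifold.maximalAtlas (𝓡 (m + 1)) ∞ Q)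
    (hg : MDifferentiableAt J (𝓡 (m + 1)).tangent g n) (hnφ : (g n).proj ∈ φ.source)
    (hnψ : (g n).proj ∈ ψ.source) (ζ : TangentSpace J n) :
    mfderiv J 𝓘(ℝ, Coord m) (fun x => velocity ψ (g x).proj (g x).2) n ζ =
      fderiv ℝ (fderiv ℝ (transition φ ψ)) (φ (g n).proj)
          (velocity φ (g n).proj (mfderiv J (𝓡 (m + 1)) (fun x => (g x).proj) n ζ))
          (velocity φ (g n).proj (g n).2) +
        fderiv ℝ (transition φ ψ) (φ (g n).proj)
          (mfderiv J 𝓘(ℝ, Coord m) (fun x => velocity φ (g x).proj (g x).2) n ζ) := by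
  rw [← mfderiv_fderiv_velocity hφ hg hnφ (contDiffAt_transition hφ hψ hnφ hnψ)]
  have hp := (mdifferentiableAt_proj_comp hg).continuousAt
  have hev : (fun x => velocity ψ (g x).proj (g x).2) =ᶠ[𝓝 n]
      fun x => fderiv ℝ (transition φ ψ) (φ (g x).proj) (velocity φ (g x).proj (g x).2) := by
    filter_upwards [hp.preimage_mem_nhds (φ.open_source.mem_nhds hnφ),
      hp.preimage_mem_nhds (ψ.open_source.mem_nhds hnψ)] with x hx hx'
    exact velocity_transition hφ hψ hx hx' _
  exact congrArg (fun L : TangentSpace J n →L[ℝ] Coord m => L ζ) hev.mfderiv_eq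

theorem second_fderiv_transition_symm (hφ : φ ∈ IsManifold.maximalAtlas (𝓡 (m + 1)) ∞ Q)
    (hψ : ψ ∈ IsManifold.maximalAtlas (𝓡 (m + 1)) ∞ Q) {q : Q} (hqφ : q ∈ φ.source)
    (hqψ : q ∈ ψ.source) (u w : Coord m) :
    fderiv ℝ (fderiv ℝ (transition φ ψ)) (φ q) u w =
      fderiv ℝ (fderiv ℝ (transition φ ψ)) (φ q) w u :=
  ((contDiffAt_transition hφ hψ hqφ hqψ).isSymmSndFDerivAt (by simp; norm_cast)).eq u w

end Charts

/-! ### Polarization on the hyperplane of unit time component -/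

section Polarization

variable {m : ℕ} {F : Type*} [AddCommGroup F] [Module ℝ F]

/-- A symmetric bilinear map which vanishes on the affine hyperplane `u⁰ = 1` is zero. -/
theorem eq_zero_of_symm_of_diag_eq_zero {B : Coord m → Coord m → F}
    (hsymm : ∀ u w, B u w = B w u) (hadd : ∀ u u' w, B (u + u') w = B u w + B u' w)
    (hsmul : ∀ (c : ℝ) u w, B (c • u) w = c • B u w) (h : ∀ u, u 0 = 1 → B u u = 0)
    (u w : Coord m) : B u w = 0 := by
  have hadd' : ∀ u w w', B u (w + w') = B u w + B u w' := fun u w w' => by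
    rw [hsymm, hadd, hsymm w, hsymm w']
  have hsmul' : ∀ (c : ℝ) u w, B u (c • w) = c • B u w := fun c u w => by
    rw [hsymm, hsmul, hsymm]
  -- By homogeneity, rescale to time component `1`.
  have hdiag : ∀ u : Coord m, u 0 ≠ 0 → B u u = 0 := fun u hu => by
    have h1 := h ((u 0)⁻¹ • u) (by simp [hu])
    rw [hsmul, hsmul', smul_smul] at h1
    exact (smul_eq_zero.mp h1).resolve_left (by simp [hu])
  have hdiag' : ∀ u : Coord m, B u u = 0 := fun u => by
    by_cases hu : u 0 = 0
    -- Both `e + u` and `e - u` have time component `1`. As `B e e = 0`, their diagonal values add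
    -- up to `2 B u u`.
    · set e : Coord m := EuclideanSpace.single 0 1
      have he : B e e = 0 := h e (by simp [e])
      have h1 := hdiag (e + u) (by simp [e, hu])
      have h2 := hdiag (e + (-1 : ℝ) • u) (by simp [e, hu])
      simp only [hadd, hadd', hsmul, hsmul', he, hsymm u e] at h1 h2
      have h3 : (2 : ℝ) • B u u = 0 := by
        calc (2 : ℝ) • B u u = (0 + B e u + (B e u + B u u)) +
            (0 + (-1 : ℝ) • B e u + ((-1 : ℝ) • B e u + (-1 : ℝ) • (-1 : ℝ) • B u u)) := by module
          _ = 0 := by rw [h1]; simpa using h2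
      exact (smul_eq_zero.mp h3).resolve_left (by norm_num)
    · exact hdiag u hu
  have h1 := hdiag' (u + w)
  simp only [hadd, hadd', hdiag', hsymm w u] at h1
  have h3 : (2 : ℝ) • B u w = 0 := by
    rw [← h1]; module
  exact (smul_eq_zero.mp h3).resolve_left (by norm_num)

end Polarization

/-! ### Accelerations, free charts and the bilinear map of a free chart -/

section FreeCharts

variable {m : ℕ} {Q : Type*} [TopologicalSpace Q] [ChartedSpace (EuclideanSpace ℝ (Fin (m + 1))) Q]
  [IsManifold (𝓡 (m + 1)) ∞ Q] {π : Q → ℝ}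
  {φ ψ ψ' : OpenPartialHomeomorph Q (EuclideanSpace ℝ (Fin (m + 1)))}

theorem mfderiv_coord {E' : Type*} [NormedAddCommGroup E'] [NormedSpace ℝ E'] {H' : Type*}
    [TopologicalSpace H'] {J : ModelWithCorners ℝ E' H'} {N : Type*} [TopologicalSpace N]
    [ChartedSpace H' N] {f : N → Coord m} {n : N} (hf : MDifferentiableAt J 𝓘(ℝ, Coord m) f n)
    (μ : Fin (m + 1)) (ζ : TangentSpace J n) :
    mfderiv J 𝓘(ℝ, ℝ) (fun x => f x μ) n ζ =
      (show Coord m from mfderiv J 𝓘(ℝ, Coord m) f n ζ) μ := by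
  have h := ((EuclideanSpace.proj μ : Coord m →L[ℝ] ℝ).hasMFDerivAt
    (x := f n)).comp n hf.hasMFDerivAt
  exact congrArg (fun L : TangentSpace J n →L[ℝ] ℝ => L ζ) h.mfderiv

/-- Differentiate `π = φ⁰`, which holds near `q`. -/
theorem IsBundleChart.velocity_time (hφ : IsBundleChart π φ) {q : Q} (hq : q ∈ φ.source)
    (v : TangentSpace (𝓡 (m + 1)) q) : velocity φ q v 0 = timeRate π ⟨q, v⟩ := by
  have hd : MDifferentiableAt (𝓡 (m + 1)) 𝓘(ℝ, Coord m) φ q :=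
    (mdifferentiable_of_mem_maximalAtlas hφ.mem_maximalAtlas).mdifferentiableAt hq
  have hev : π =ᶠ[𝓝 q] fun p => φ p 0 := by
    filter_upwards [φ.open_source.mem_nhds hq] with p hp
    exact (hφ.time_coord p hp).symm
  exact (mfderiv_coord hd 0 v).symm.trans
    (congrArg (fun L : TangentSpace (𝓡 (m + 1)) q →L[ℝ] ℝ => L v) hev.mfderiv_eq).symm

theorem IsBundleChart.velocity_time_of_mem_jetOne (hφ : IsBundleChart π φ)
    {v : TangentBundle (𝓡 (m + 1)) Q} (hv : v ∈ jetOne π) (hvφ : v.proj ∈ φ.source) :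
    velocity φ v.proj v.2 0 = 1 :=
  (hφ.velocity_time hvφ v.2).trans hv

theorem IsBundleChart.exists_mem_jetOne (hφ : IsBundleChart π φ) {q : Q} (hq : q ∈ φ.source)
    {u : Coord m} (hu : u 0 = 1) : ∃ v : TangentSpace (𝓡 (m + 1)) q,
      (⟨q, v⟩ : TangentBundle (𝓡 (m + 1)) Q) ∈ jetOne π ∧ velocity φ q v = u := by
  obtain ⟨v, rfl⟩ := velocity_surjective hφ.mem_maximalAtlas hq u
  exact ⟨v, (hφ.velocity_time hq v).symm.trans hu, rfl⟩

/-- The derivative of the fibre coordinates `q̇` of `φ` along a dynamic equation. -/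
def DynamicEquation.acceleration (ξ : DynamicEquation m π)
    (φ : OpenPartialHomeomorph Q (Coord m)) (v : TangentBundle (𝓡 (m + 1)) Q) : Coord m :=
  mfderiv (𝓡 (m + 1)).tangent 𝓘(ℝ, Coord m)
    (fun w : TangentBundle (𝓡 (m + 1)) Q => velocity φ w.proj w.2) v (ξ.toFun v)

variable {ξ : DynamicEquation m π}

theorem DynamicEquation.acceleration_time (hφ : IsBundleChart π φ)
    {v : TangentBundle (𝓡 (m + 1)) Q} (hv : v ∈ jetOne π) (hvφ : v.proj ∈ φ.source) :
    ξ.acceleration φ v 0 = 0 := by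
  have hd := (contMDiffAt_velocity hφ.mem_maximalAtlas hvφ).mdifferentiableAt (by simp)
  have hev : timeRate π =ᶠ[𝓝 v]
      fun w : TangentBundle (𝓡 (m + 1)) Q => velocity φ w.proj w.2 0 := by
    filter_upwards [(FiberBundle.continuous_proj (Coord m)
      (TangentSpace (𝓡 (m + 1)))).continuousAt.preimage_mem_nhds
      (φ.open_source.mem_nhds hvφ)] with w hw
    exact (hφ.velocity_time hw w.2).symm
  have h := ξ.tangent v hv
  rw [hev.mfderiv_eq] at h
  exact (mfderiv_coord hd 0 (ξ.toFun v)).symm.trans h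

/-- Holonomy says that the base component of `ξ` at `v` is `v` itself, which puts the second
derivative on the diagonal. -/
theorem DynamicEquation.acceleration_transition
    (hφ : φ ∈ IsManifold.maximalAtlas (𝓡 (m + 1)) ∞ Q)
    (hψ : ψ ∈ IsManifold.maximalAtlas (𝓡 (m + 1)) ∞ Q) {v : TangentBundle (𝓡 (m + 1)) Q}
    (hv : v ∈ jetOne π) (hvφ : v.proj ∈ φ.source) (hvψ : v.proj ∈ ψ.source) :
    ξ.acceleration ψ v = fderiv ℝ (fderiv ℝ (transition φ ψ)) (φ v.proj)
        (velocity φ v.proj v.2) (velocity φ v.proj v.2) +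
      fderiv ℝ (transition φ ψ) (φ v.proj) (ξ.acceleration φ v) := by
  have h := mfderiv_velocity_transition (g := fun w => w) hφ hψ mdifferentiableAt_id hvφ hvψ
    (ξ.toFun v)
  rw [ξ.holonomic v hv] at h
  exact h

/-- Bundle coordinates in which the dynamic equation reads `qⁱₜₜ = 0`. -/
structure DynamicEquation.IsFreeChart (ξ : DynamicEquation m π)
    (ψ : OpenPartialHomeomorph Q (Coord m)) : Prop where
  isBundleChart : IsBundleChart π ψ
  acceleration_eq_zero : ∀ v ∈ jetOne π, v.proj ∈ ψ.source → ξ.acceleration ψ v = 0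

theorem DynamicEquation.IsFreeMotion.exists_isFreeChart (hξ : ξ.IsFreeMotion) (q : Q) :
    ∃ ψ : OpenPartialHomeomorph Q (Coord m), q ∈ ψ.source ∧ ξ.IsFreeChart ψ := by
  obtain ⟨Γ, hΓ⟩ := hξ
  obtain ⟨ψ, hq, hψ, h⟩ := hΓ q
  -- The frame is dropped here: only the vanishing acceleration in bundle coordinates is used later.
  -- The time component comes from tangency, the others from the free motion hypothesis.
  refine ⟨ψ, hq, hψ.1, fun v hv hvψ => ?_⟩
  ext μ
  refine Fin.cases (acceleration_time hψ.1 hv hvψ) (fun i => ?_) μ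
  exact h v hv hvψ i

/-- With both accelerations zero, the transformation law reduces to `T''(u, u) = 0` for `u⁰ = 1`;
every such `u` is the velocity of some jet, so polarization applies. -/
theorem DynamicEquation.IsFreeChart.second_fderiv_eq_zero (hψ : ξ.IsFreeChart ψ)
    (hψ' : ξ.IsFreeChart ψ') {q : Q} (hq : q ∈ ψ.source) (hq' : q ∈ ψ'.source) (u w : Coord m) :
    fderiv ℝ (fderiv ℝ (transition ψ ψ')) (ψ q) u w = 0 := by
  have hm := hψ.isBundleChart.mem_maximalAtlas
  have hm' := hψ'.isBundleChart.mem_maximalAtlas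
  refine eq_zero_of_symm_of_diag_eq_zero
    (B := fun u w => fderiv ℝ (fderiv ℝ (transition ψ ψ')) (ψ q) u w)
    (second_fderiv_transition_symm hm hm' hq hq')
    (fun u u' w => by simp) (fun c u w => by simp) (fun u hu => ?_) u w
  obtain ⟨v, hv, rfl⟩ := hψ.isBundleChart.exists_mem_jetOne hq hu
  have h := acceleration_transition (ξ := ξ) hm hm' hv hq hq'
  rw [hψ.acceleration_eq_zero _ hv hq, hψ'.acceleration_eq_zero _ hv hq', map_zero, add_zero] at h
  exact h.symm

/-- The connection coefficients in the coordinates `φ` of the connection which is flat in the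
coordinates `ψ`. -/
def flatCoefficients (φ ψ : OpenPartialHomeomorph Q (Coord m)) (q : Q) (u w : Coord m) : Coord m :=
  -fderiv ℝ (transition ψ φ) (ψ q) (fderiv ℝ (fderiv ℝ (transition φ ψ)) (φ q) u w)

theorem flatCoefficients_add (q : Q) (u u' w : Coord m) : flatCoefficients φ ψ q (u + u') w =
    flatCoefficients φ ψ q u w + flatCoefficients φ ψ q u' w := by
  simp [flatCoefficients, add_comm]

theorem flatCoefficients_smul (c : ℝ) (q : Q) (u w : Coord m) :
    flatCoefficients φ ψ q (c • u) w = c • flatCoefficients φ ψ q u w := by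
  simp [flatCoefficients]

theorem flatCoefficients_symm (hφ : φ ∈ IsManifold.maximalAtlas (𝓡 (m + 1)) ∞ Q)
    (hψ : ψ ∈ IsManifold.maximalAtlas (𝓡 (m + 1)) ∞ Q) {q : Q} (hqφ : q ∈ φ.source)
    (hqψ : q ∈ ψ.source) (u w : Coord m) :
    flatCoefficients φ ψ q u w = flatCoefficients φ ψ q w u := by
  rw [flatCoefficients, second_fderiv_transition_symm hφ hψ hqφ hqψ, flatCoefficients]

theorem flatCoefficients_eq_sum (q : Q) (u w : Coord m) (μ : Fin (m + 1)) :
    flatCoefficients φ ψ q u w μ = ∑ l, ∑ ν,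
      flatCoefficients φ ψ q (EuclideanSpace.single l 1) (EuclideanSpace.single ν 1) μ *
        u l * w ν := by
  have hu : ∀ u : Coord m, u = ∑ l, u l • EuclideanSpace.single l (1 : ℝ) := fun u => by
    simpa using ((EuclideanSpace.basisFun (Fin (m + 1)) ℝ).sum_repr u).symm
  conv_lhs => rw [hu u, hu w]
  simp only [flatCoefficients, map_sum, map_smul, sum_apply,
    smul_apply]
  simp only [PiLp.neg_apply, WithLp.ofLp_sum, Finset.sum_apply, PiLp.smul_apply, smul_eq_mul,
    ← Finset.sum_neg_distrib, Finset.mul_sum]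
  rw [Finset.sum_comm]
  exact Finset.sum_congr rfl fun _ _ => Finset.sum_congr rfl fun _ _ => by ring

/-- The transformation law from `φ` to `ψ`, multiplied by `(T')⁻¹`: an ordinary derivative in `ψ`
reads in `φ` as a derivative corrected by a Christoffel-type term. -/
theorem fderiv_mfderiv_velocity {E' : Type*} [NormedAddCommGroup E'] [NormedSpace ℝ E']
    {H' : Type*} [TopologicalSpace H'] {J : ModelWithCorners ℝ E' H'} {N : Type*}
    [TopologicalSpace N] [ChartedSpace H' N] {g : N → TangentBundle (𝓡 (m + 1)) Q} {n : N}
    (hφ : φ ∈ IsManifold.maximalAtlas (𝓡 (m + 1)) ∞ Q)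
    (hψ : ψ ∈ IsManifold.maximalAtlas (𝓡 (m + 1)) ∞ Q)
    (hg : MDifferentiableAt J (𝓡 (m + 1)).tangent g n) (hnφ : (g n).proj ∈ φ.source)
    (hnψ : (g n).proj ∈ ψ.source) (ζ : TangentSpace J n) :
    fderiv ℝ (transition ψ φ) (ψ (g n).proj)
        (mfderiv J 𝓘(ℝ, Coord m) (fun x => velocity ψ (g x).proj (g x).2) n ζ) =
      (show Coord m from
        mfderiv J 𝓘(ℝ, Coord m) (fun x => velocity φ (g x).proj (g x).2) n ζ) -
        flatCoefficients φ ψ (g n).proj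
          (velocity φ (g n).proj (mfderiv J (𝓡 (m + 1)) (fun x => (g x).proj) n ζ))
          (velocity φ (g n).proj (g n).2) := by
  have h := mfderiv_velocity_transition hφ hψ hg hnφ hnψ ζ
  refine (congrArg (fderiv ℝ (transition ψ φ) (ψ (g n).proj)) h).trans ?_
  refine (map_add (fderiv ℝ (transition ψ φ) (ψ (g n).proj)) _ _).trans ?_
  rw [flatCoefficients, sub_neg_eq_add, add_comm]
  congr 1
  exact fderiv_transition_comp hφ hψ hnφ hnψ _

theorem DynamicEquation.IsFreeChart.acceleration_eq (hψ : ξ.IsFreeChart ψ)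
    (hφ : φ ∈ IsManifold.maximalAtlas (𝓡 (m + 1)) ∞ Q) {v : TangentBundle (𝓡 (m + 1)) Q}
    (hv : v ∈ jetOne π) (hvφ : v.proj ∈ φ.source) (hvψ : v.proj ∈ ψ.source) :
    ξ.acceleration φ v =
      flatCoefficients φ ψ v.proj (velocity φ v.proj v.2) (velocity φ v.proj v.2) := by
  have h := acceleration_transition (ξ := ξ) hφ hψ.isBundleChart.mem_maximalAtlas hv hvφ hvψ
  rw [hψ.acceleration_eq_zero v hv hvψ] at h
  have h1 := congrArg (fderiv ℝ (transition ψ φ) (ψ v.proj)) h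
  rw [map_zero, map_add, fderiv_transition_comp hφ hψ.isBundleChart.mem_maximalAtlas hvφ hvψ] at h1
  exact (neg_eq_of_add_eq_zero_right h1.symm).symm

/-- On velocities with `u⁰ = 1` both diagonals equal the acceleration in `φ`, which knows nothing of
the free chart; polarization extends the equality to all arguments. -/
theorem DynamicEquation.IsFreeChart.flatCoefficients_eq (hψ : ξ.IsFreeChart ψ)
    (hψ' : ξ.IsFreeChart ψ') (hφ : IsBundleChart π φ) {q : Q} (hqφ : q ∈ φ.source)
    (hq : q ∈ ψ.source) (hq' : q ∈ ψ'.source) (u w : Coord m) :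
    flatCoefficients φ ψ q u w = flatCoefficients φ ψ' q u w := by
  have hm := hφ.mem_maximalAtlas
  rw [← sub_eq_zero]
  refine eq_zero_of_symm_of_diag_eq_zero
    (B := fun u w => flatCoefficients φ ψ q u w - flatCoefficients φ ψ' q u w)
    (fun u w => ?_) (fun u u' w => ?_) (fun c u w => ?_) (fun u hu => ?_) u w
  · rw [flatCoefficients_symm hm hψ.isBundleChart.mem_maximalAtlas hqφ hq,
      flatCoefficients_symm hm hψ'.isBundleChart.mem_maximalAtlas hqφ hq']
  · simp only [flatCoefficients_add]; abel
  · simp only [flatCoefficients_smul, smul_sub]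
  · obtain ⟨v, hv, rfl⟩ := hφ.exists_mem_jetOne hqφ hu
    have h := hψ.acceleration_eq hm hv hqφ hq
    have h' := hψ'.acceleration_eq hm hv hqφ hq'
    exact sub_eq_zero.mpr (h.symm.trans h')

theorem DynamicEquation.IsFreeChart.flatCoefficients_time (hψ : ξ.IsFreeChart ψ)
    (hφ : IsBundleChart π φ) {q : Q} (hqφ : q ∈ φ.source) (hq : q ∈ ψ.source) (u w : Coord m) :
    flatCoefficients φ ψ q u w 0 = 0 := by
  have hm := hφ.mem_maximalAtlas
  refine eq_zero_of_symm_of_diag_eq_zero (B := fun u w => flatCoefficients φ ψ q u w 0)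
    (fun u w => ?_) (fun u u' w => ?_) (fun c u w => ?_) (fun u hu => ?_) u w
  · rw [flatCoefficients_symm hm hψ.isBundleChart.mem_maximalAtlas hqφ hq]
  · simp only [flatCoefficients_add, PiLp.add_apply]
  · simp only [flatCoefficients_smul, PiLp.smul_apply]
  · obtain ⟨v, hv, rfl⟩ := hφ.exists_mem_jetOne hqφ hu
    have h := hψ.acceleration_eq hm hv hqφ hq
    have h' := acceleration_time (ξ := ξ) hφ hv hqφ
    rw [h] at h'
    exact h'

theorem contMDiffAt_flatCoefficients (hφ : φ ∈ IsManifold.maximalAtlas (𝓡 (m + 1)) ∞ Q)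
    (hψ : ψ ∈ IsManifold.maximalAtlas (𝓡 (m + 1)) ∞ Q) {q : Q} (hqφ : q ∈ φ.source)
    (hqψ : q ∈ ψ.source) (u w : Coord m) (μ : Fin (m + 1)) :
    ContMDiffAt (𝓡 (m + 1)) 𝓘(ℝ, ℝ) ∞ (fun p => flatCoefficients φ ψ p u w μ) q := by
  have hφs : ContMDiffAt (𝓡 (m + 1)) 𝓘(ℝ, Coord m) ∞ φ q :=
    contMDiffAt_of_mem_maximalAtlas hφ hqφ
  have hψs : ContMDiffAt (𝓡 (m + 1)) 𝓘(ℝ, Coord m) ∞ ψ q :=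
    contMDiffAt_of_mem_maximalAtlas hψ hqψ
  have h1 : ContDiffAt ℝ ∞ (fderiv ℝ (fderiv ℝ (transition φ ψ))) (φ q) :=
    ((contDiffAt_transition hφ hψ hqφ hqψ).fderiv_right (m := ∞) (by simp)).fderiv_right
      (m := ∞) (by simp)
  have h2 : ContDiffAt ℝ ∞ (fderiv ℝ (transition ψ φ)) (ψ q) :=
    (contDiffAt_transition hψ hφ hqψ hqφ).fderiv_right (m := ∞) (by simp)
  have h3 := (h1.contMDiffAt.comp q hφs).clm_apply (contMDiffAt_const (c := u))
  have h4 := h3.clm_apply (contMDiffAt_const (c := w))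
  have h5 := (h2.contMDiffAt.comp q hψs).clm_apply h4
  have h6 := (EuclideanSpace.proj μ : Coord m →L[ℝ] ℝ).contMDiff.contMDiffAt.comp q h5.neg
  exact h6

end FreeCharts

/-! ### The connection of the free charts: components, quadratic form, uniqueness -/

section FlatConnection

variable {m : ℕ} {Q : Type*} [TopologicalSpace Q] [ChartedSpace (EuclideanSpace ℝ (Fin (m + 1))) Q]
  [IsManifold (𝓡 (m + 1)) ∞ Q] {π : Q → ℝ} {ξ : DynamicEquation m π}
  {φ ψ : OpenPartialHomeomorph Q (EuclideanSpace ℝ (Fin (m + 1)))}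

/-- A chosen free chart around a point. -/
def freeChart (hξ : ξ.IsFreeMotion) (q : Q) : OpenPartialHomeomorph Q (Coord m) :=
  (hξ.exists_isFreeChart q).choose

theorem mem_freeChart_source (hξ : ξ.IsFreeMotion) (q : Q) : q ∈ (freeChart hξ q).source :=
  (hξ.exists_isFreeChart q).choose_spec.1

theorem isFreeChart_freeChart (hξ : ξ.IsFreeMotion) (q : Q) : ξ.IsFreeChart (freeChart hξ q) :=
  (hξ.exists_isFreeChart q).choose_spec.2

theorem freeChart_mem_maximalAtlas (hξ : ξ.IsFreeMotion) (q : Q) :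
    freeChart hξ q ∈ IsManifold.maximalAtlas (𝓡 (m + 1)) ∞ Q :=
  (isFreeChart_freeChart hξ q).isBundleChart.mem_maximalAtlas

/-- The covariant derivative which is the ordinary derivative of components in free charts. -/
def flatDerivative (hξ : ξ.IsFreeMotion) (Z : ∀ p : Q, TangentSpace (𝓡 (m + 1)) p) (q : Q) :
    TangentSpace (𝓡 (m + 1)) q →L[ℝ] TangentSpace (𝓡 (m + 1)) q :=
  ((velocityEquiv (freeChart_mem_maximalAtlas hξ q) (mem_freeChart_source hξ q)).symm :
    Coord m →L[ℝ] TangentSpace (𝓡 (m + 1)) q).comp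
      (mfderiv (𝓡 (m + 1)) 𝓘(ℝ, Coord m) (fun p => velocity (freeChart hξ q) p (Z p)) q)

theorem velocity_freeChart_flatDerivative (hξ : ξ.IsFreeMotion)
    (Z : ∀ p : Q, TangentSpace (𝓡 (m + 1)) p) (q : Q) (v : TangentSpace (𝓡 (m + 1)) q) :
    velocity (freeChart hξ q) q (flatDerivative hξ Z q v) =
      mfderiv (𝓡 (m + 1)) 𝓘(ℝ, Coord m) (fun p => velocity (freeChart hξ q) p (Z p)) q v :=
  (velocityEquiv (freeChart_mem_maximalAtlas hξ q) (mem_freeChart_source hξ q)).apply_symm_apply _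

/-- The linear connection defined by the atlas of free charts of a free motion equation. -/
def flatConnection (hξ : ξ.IsFreeMotion) : LinearConnection m Q where
  toFun := flatDerivative hξ
  isCovariantDerivativeOnUniv := by
    refine ⟨fun {σ σ' q} hσ hσ' _ => ?_, fun {σ g q} hσ hg _ => ?_⟩
    · ext1 v
      have hm := freeChart_mem_maximalAtlas hξ q
      have hq := mem_freeChart_source hξ q
      have h := mdifferentiableAt_velocity_comp hm hσ hq
      have h' := mdifferentiableAt_velocity_comp hm hσ' hq
      refine velocity_injective hm hq ?_
      refine (velocity_freeChart_flatDerivative hξ _ q v).trans ?_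
      refine Eq.trans ?_ (map_add (velocityEquiv hm hq) (flatDerivative hξ σ q v)
        (flatDerivative hξ σ' q v)).symm
      simp only [velocityEquiv_apply, velocity_freeChart_flatDerivative]
      have h3 := (h.hasMFDerivAt.add h'.hasMFDerivAt).congr_of_eventuallyEq
        (f₁ := fun p => velocity (freeChart hξ q) p ((σ + σ') p))
        (Filter.Eventually.of_forall fun p => map_add (mfderiv _ _ _ p) (σ p) (σ' p))
      exact congrArg (fun L : TangentSpace (𝓡 (m + 1)) q →L[ℝ] Coord m => L v) h3.mfderiv
    · ext1 v
      have hm := freeChart_mem_maximalAtlas hξ q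
      have hq := mem_freeChart_source hξ q
      have h := mdifferentiableAt_velocity_comp hm hσ hq
      refine velocity_injective hm hq ?_
      refine (velocity_freeChart_flatDerivative hξ _ q v).trans ?_
      have h3 := (hasMFDerivAt_smul hg.hasMFDerivAt h.hasMFDerivAt).congr_of_eventuallyEq
        (f₁ := fun p => velocity (freeChart hξ q) p ((g • σ) p))
        (Filter.Eventually.of_forall fun p => map_smul (mfderiv _ _ _ p) (g p) (σ p))
      refine (congrArg (fun L : TangentSpace (𝓡 (m + 1)) q →L[ℝ] Coord m => L v) h3.mfderiv).trans ?_
      refine Eq.trans ?_ (map_add (velocityEquiv hm hq) (g q • flatDerivative hξ σ q v)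
        ((show ℝ from mfderiv (𝓡 (m + 1)) 𝓘(ℝ, ℝ) g q v) • σ q)).symm
      rw [map_smul, map_smul]
      simp only [velocityEquiv_apply, velocity_freeChart_flatDerivative]
      rfl

/-- The definition uses one chosen free chart at each point. Any other will do, since the second
derivative of the transition vanishes and derivatives of components transform as vectors. -/
theorem velocity_flatConnection (hξ : ξ.IsFreeMotion) (hψ : ξ.IsFreeChart ψ) {q : Q}
    (hq : q ∈ ψ.source) {Z : ∀ p : Q, TangentSpace (𝓡 (m + 1)) p}
    (hZ : MDifferentiableAt (𝓡 (m + 1)) (𝓡 (m + 1)).tangent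
      (fun p => (⟨p, Z p⟩ : TangentBundle (𝓡 (m + 1)) Q)) q) (v : TangentSpace (𝓡 (m + 1)) q) :
    velocity ψ q (flatConnection hξ Z q v) =
      mfderiv (𝓡 (m + 1)) 𝓘(ℝ, Coord m) (fun p => velocity ψ p (Z p)) q v := by
  have hm := freeChart_mem_maximalAtlas hξ q
  have hq₀ := mem_freeChart_source hξ q
  have h := mfderiv_velocity_transition hm hψ.isBundleChart.mem_maximalAtlas hZ hq₀ hq v
  rw [(isFreeChart_freeChart hξ q).second_fderiv_eq_zero hψ hq₀ hq, zero_add] at h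
  rw [velocity_transition hm hψ.isBundleChart.mem_maximalAtlas hq₀ hq]
  refine Eq.trans ?_ h.symm
  exact congrArg _ (velocity_freeChart_flatDerivative hξ Z q v)

theorem velocity_flatConnection_eq_sub (hξ : ξ.IsFreeMotion) (hψ : ξ.IsFreeChart ψ)
    (hφ : φ ∈ IsManifold.maximalAtlas (𝓡 (m + 1)) ∞ Q) {q : Q} (hqφ : q ∈ φ.source)
    (hq : q ∈ ψ.source) {Z : ∀ p : Q, TangentSpace (𝓡 (m + 1)) p}
    (hZ : MDifferentiableAt (𝓡 (m + 1)) (𝓡 (m + 1)).tangent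
      (fun p => (⟨p, Z p⟩ : TangentBundle (𝓡 (m + 1)) Q)) q) (v : TangentSpace (𝓡 (m + 1)) q) :
    velocity φ q (flatConnection hξ Z q v) =
      (show Coord m from
        mfderiv (𝓡 (m + 1)) 𝓘(ℝ, Coord m) (fun p => velocity φ p (Z p)) q v) -
        flatCoefficients φ ψ q (velocity φ q v) (velocity φ q (Z q)) := by
  have hm := hψ.isBundleChart.mem_maximalAtlas
  rw [velocity_transition hm hφ hq hqφ, velocity_flatConnection hξ hψ hq hZ]
  have h := fderiv_mfderiv_velocity hφ hm hZ hqφ hq v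
  have hid : mfderiv (𝓡 (m + 1)) (𝓡 (m + 1)) (fun p : Q => p) q v = v :=
    congrArg (fun L : TangentSpace (𝓡 (m + 1)) q →L[ℝ] TangentSpace (𝓡 (m + 1)) q => L v)
      (mfderiv_id (I := 𝓡 (m + 1)) (x := q))
  refine h.trans ?_
  change _ - flatCoefficients φ ψ q (velocity φ q (mfderiv (𝓡 (m + 1)) (𝓡 (m + 1))
    (fun p : Q => p) q v)) _ = _
  rw [hid]

/-- The connection coefficients of the flat connection in the coordinates `φ`. -/
def connectionCoefficients (hξ : ξ.IsFreeMotion) (φ : OpenPartialHomeomorph Q (Coord m))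
    (l μ ν : Fin (m + 1)) (q : Q) : ℝ :=
  flatCoefficients φ (freeChart hξ q) q (EuclideanSpace.single l 1) (EuclideanSpace.single ν 1) μ

theorem connectionCoefficients_symm (hξ : ξ.IsFreeMotion) (hφ : IsBundleChart π φ) {q : Q}
    (hq : q ∈ φ.source) (l μ ν : Fin (m + 1)) :
    connectionCoefficients hξ φ l μ ν q = connectionCoefficients hξ φ ν μ l q := by
  rw [connectionCoefficients, flatCoefficients_symm hφ.mem_maximalAtlas
    (freeChart_mem_maximalAtlas hξ q) hq (mem_freeChart_source hξ q), connectionCoefficients]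

theorem connectionCoefficients_time (hξ : ξ.IsFreeMotion) (hφ : IsBundleChart π φ) {q : Q}
    (hq : q ∈ φ.source) (l ν : Fin (m + 1)) : connectionCoefficients hξ φ l 0 ν q = 0 :=
  (isFreeChart_freeChart hξ q).flatCoefficients_time hφ hq (mem_freeChart_source hξ q) _ _

theorem contMDiffOn_connectionCoefficients (hξ : ξ.IsFreeMotion) (hφ : IsBundleChart π φ)
    (l μ ν : Fin (m + 1)) :
    ContMDiffOn (𝓡 (m + 1)) 𝓘(ℝ, ℝ) ∞ (connectionCoefficients hξ φ l μ ν) φ.source := by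
  intro q hq
  have hqψ := mem_freeChart_source hξ q
  refine ContMDiffAt.contMDiffWithinAt ((contMDiffAt_flatCoefficients hφ.mem_maximalAtlas
    (freeChart_mem_maximalAtlas hξ q) hq hqψ (EuclideanSpace.single l 1)
    (EuclideanSpace.single ν 1) μ).congr_of_eventuallyEq ?_)
  -- The chosen free chart jumps from point to point; by independence of the choice, the chart
  -- chosen at `q` can be used throughout a neighbourhood.
  filter_upwards [φ.open_source.mem_nhds hq, (freeChart hξ q).open_source.mem_nhds hqψ] with p hp hp'
  exact congrArg (fun u : Coord m => u μ) ((isFreeChart_freeChart hξ p).flatCoefficients_eq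
    (isFreeChart_freeChart hξ q) hφ hp (mem_freeChart_source hξ p) hp' _ _)

theorem hasComponents_flatConnection (hξ : ξ.IsFreeMotion) (hφ : IsBundleChart π φ) :
    LinearConnection.HasComponents (flatConnection hξ) φ (connectionCoefficients hξ φ) := by
  intro q hq Z hZ v μ
  rw [velocity_flatConnection_eq_sub hξ (isFreeChart_freeChart hξ q) hφ.mem_maximalAtlas hq
    (mem_freeChart_source hξ q) hZ, mfderiv_coord
    (mdifferentiableAt_velocity_comp hφ.mem_maximalAtlas hZ hq), PiLp.sub_apply,
    flatCoefficients_eq_sum]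
  rfl

theorem quadraticComponents_connectionCoefficients (hξ : ξ.IsFreeMotion) (hφ : IsBundleChart π φ)
    {q : Q} (hq : q ∈ φ.source) (l μ ν : Fin (m + 1)) :
    quadraticComponents (fun i j k => connectionCoefficients hξ φ j.succ i.succ k.succ)
      (fun i j q => 2 * connectionCoefficients hξ φ 0 i.succ j.succ q)
      (fun i => connectionCoefficients hξ φ 0 i.succ 0) l μ ν q =
    connectionCoefficients hξ φ l μ ν q := by
  cases μ using Fin.cases with
  | zero => exact (connectionCoefficients_time hξ hφ hq l ν).symm
  | succ i =>
    cases l using Fin.cases <;> cases ν using Fin.cases <;> simp [quadraticComponents]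
    -- Only `l` spatial, `ν = 0` remains: `b` was read off from the entries with `l = 0`, so
    -- symmetry is needed.
    exact connectionCoefficients_symm hξ hφ hq _ _ _

theorem hasQuadraticForm_connectionCoefficients (hξ : ξ.IsFreeMotion) (hφ : IsBundleChart π φ) :
    ξ.HasQuadraticForm φ (fun i j k => connectionCoefficients hξ φ j.succ i.succ k.succ)
      (fun i j q => 2 * connectionCoefficients hξ φ 0 i.succ j.succ q)
      (fun i => connectionCoefficients hξ φ 0 i.succ 0) where
  symm i j k q hq := connectionCoefficients_symm hξ hφ hq _ _ _
  smooth_a i j k := contMDiffOn_connectionCoefficients hξ hφ _ _ _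
  smooth_b i j := contMDiffOn_const.mul (contMDiffOn_connectionCoefficients hξ hφ _ _ _)
  smooth_f i := contMDiffOn_connectionCoefficients hξ hφ _ _ _
  component_eq v hv hvφ i := by
    have h := (isFreeChart_freeChart hξ v.proj).acceleration_eq hφ.mem_maximalAtlas hv hvφ
      (mem_freeChart_source hξ v.proj)
    have h1 : ξ.component φ v i = flatCoefficients φ (freeChart hξ v.proj) v.proj
        (velocity φ v.proj v.2) (velocity φ v.proj v.2) i.succ :=
      congrArg (fun u : Coord m => u i.succ) h
    rw [h1, flatCoefficients_eq_sum]
    change ∑ l, ∑ ν, connectionCoefficients hξ φ l i.succ ν v.proj * _ * _ = _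
    have h2 : ∀ j : Fin m, connectionCoefficients hξ φ j.succ i.succ 0 v.proj =
      connectionCoefficients hξ φ 0 i.succ j.succ v.proj := fun j =>
        connectionCoefficients_symm hξ hφ hvφ _ _ _
    -- With time velocity `1`, the `(0, 0)` term is `f`, and the two mixed sums, equal by `h2`,
    -- combine to `b`; hence the factor `2` there.
    simp only [Fin.sum_univ_succ, hφ.velocity_time_of_mem_jetOne hv hvφ, h2, mul_one,
      Finset.sum_add_distrib, mul_assoc, one_mul, two_mul, add_mul]
    ring

theorem correspondsTo_flatConnection (hξ : ξ.IsFreeMotion) :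
    LinearConnection.CorrespondsTo (flatConnection hξ) ξ := by
  intro φ hφ
  refine ⟨_, _, _, hasQuadraticForm_connectionCoefficients hξ hφ, fun q hq Z hZ v μ => ?_⟩
  simp only [quadraticComponents_connectionCoefficients hξ hφ hq]
  exact hasComponents_flatConnection hξ hφ q hq Z hZ v μ

/-- Evaluation at `0` isolates `f`, at `± eⱼ` the diagonal of `a` and `b`, and at `eⱼ + eₖ` the
symmetric off-diagonal part. -/
theorem quadratic_coefficients_eq_zero {a : Fin m → Fin m → ℝ} {b : Fin m → ℝ} {f : ℝ}
    (ha : ∀ j k, a j k = a k j)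
    (h : ∀ u : Fin m → ℝ, (∑ j, ∑ k, a j k * u j * u k) + (∑ j, b j * u j) + f = 0) :
    (∀ j k, a j k = 0) ∧ (∀ j, b j = 0) ∧ f = 0 := by
  have hf : f = 0 := by simpa using h 0
  have h1 : ∀ j, a j j + b j = 0 := fun j => by
    simpa [hf, Pi.single_apply] using h (Pi.single j 1)
  have h2 : ∀ j, a j j - b j = 0 := fun j => by
    simpa [hf, Pi.single_apply, sub_eq_add_neg] using h (Pi.single j (-1))
  have hd : ∀ j, a j j = 0 := fun j => by linarith [h1 j, h2 j]
  have hb : ∀ j, b j = 0 := fun j => by linarith [h1 j, h2 j]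
  refine ⟨fun j k => ?_, hb, hf⟩
  have h3 := h (Pi.single j 1 + Pi.single k 1)
  simp only [Pi.add_apply, Pi.single_apply, mul_add, mul_ite, mul_one, mul_zero,
    Finset.sum_add_distrib, Finset.sum_ite_eq', Finset.mem_univ,
    if_true, hf, hb, hd] at h3
  simp at h3
  linarith [ha j k]

/-- Tested in a free chart: the quadratic form of `ξ` is zero for all velocities, so its
coefficients and with them all components of `K` vanish, and `K` differentiates components just as
the flat connection does. -/
theorem sameAs_flatConnection (hξ : ξ.IsFreeMotion) (K : LinearConnection m Q)
    (hK : K.CorrespondsTo ξ) : K.SameAs (flatConnection hξ) := by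
  intro q Z hZ
  have hψ := isFreeChart_freeChart hξ q
  have hq := mem_freeChart_source hξ q
  set ψ := freeChart hξ q
  have hm := hψ.isBundleChart.mem_maximalAtlas
  obtain ⟨a, b, f, hquad, hcomp⟩ := hK ψ hψ.isBundleChart
  have hz : ∀ i, (∀ j k, a i j k q = 0) ∧ (∀ j, b i j q = 0) ∧ f i q = 0 := fun i => by
    refine quadratic_coefficients_eq_zero (fun j k => hquad.symm i j k q hq) fun u => ?_
    obtain ⟨v, hv, hvu⟩ := hψ.isBundleChart.exists_mem_jetOne hq
      (u := WithLp.toLp 2 (Fin.cons 1 u)) (by simp)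
    have h := hquad.component_eq ⟨q, v⟩ hv hq i
    have h0 : ξ.component ψ ⟨q, v⟩ i = 0 :=
      congrArg (fun u : Coord m => u i.succ) (hψ.acceleration_eq_zero ⟨q, v⟩ hv hq)
    rw [h0] at h
    simpa [hvu] using h.symm
  ext1 v
  refine velocity_injective hm hq ?_
  rw [velocity_flatConnection hξ hψ hq hZ]
  ext μ
  rw [hcomp q hq Z hZ v μ, mfderiv_coord (mdifferentiableAt_velocity_comp hm hZ hq)]
  have hk : ∀ l ν, quadraticComponents a b f l μ ν q = 0 := fun l ν => by
    cases μ using Fin.cases <;> cases l using Fin.cases <;> cases ν using Fin.cases <;>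
      simp [quadraticComponents, hz]
  simp [hk]

end FlatConnection

/-! ### Smoothness, torsion and curvature -/

section Curvature

variable {m : ℕ} {Q : Type*} [TopologicalSpace Q] [ChartedSpace (EuclideanSpace ℝ (Fin (m + 1))) Q]
  [IsManifold (𝓡 (m + 1)) ∞ Q] {π : Q → ℝ} {ξ : DynamicEquation m π}
  {φ ψ : OpenPartialHomeomorph Q (EuclideanSpace ℝ (Fin (m + 1)))}
  {X Y Z : ∀ p : Q, TangentSpace (𝓡 (m + 1)) p} {q : Q}

theorem mpullback_chart_symm (hφ : φ ∈ IsManifold.maximalAtlas (𝓡 (m + 1)) ∞ Q) {x : Coord m}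
    (hx : x ∈ φ.target) :
    VectorField.mpullback (𝓡 (m + 1)) (𝓡 (m + 1)) φ.symm X x =
      velocity φ (φ.symm x) (X (φ.symm x)) := by
  have hm := mdifferentiable_of_mem_maximalAtlas hφ
  exact congrArg (fun L : TangentSpace (𝓡 (m + 1)) (φ.symm x) →L[ℝ] Coord m => L (X (φ.symm x)))
    (ContinuousLinearMap.inverse_equiv (hm.symm.mfderiv hx))

theorem mlieBracket_coord (V W : ∀ x : Coord m, TangentSpace (𝓡 (m + 1)) x) (x : Coord m) :
    VectorField.mlieBracket (𝓡 (m + 1)) V W x = VectorField.lieBracket ℝ V W x := by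
  have h := congrFun (VectorField.mlieBracketWithin_eq_lieBracketWithin (𝕜 := ℝ) (V := V) (W := W)
    (s := Set.univ)) x
  rw [VectorField.mlieBracketWithin_univ] at h
  exact h.trans (congrFun VectorField.lieBracketWithin_univ x)

/-- Lie brackets commute with pullback along `φ.symm`, and pulling back a field along `φ.symm`
yields its fibre coordinates. -/
theorem velocity_mlieBracket (hφ : φ ∈ IsManifold.maximalAtlas (𝓡 (m + 1)) ∞ Q)
    (hq : q ∈ φ.source)
    (hX : MDifferentiableAt (𝓡 (m + 1)) (𝓡 (m + 1)).tangent
      (fun p => (⟨p, X p⟩ : TangentBundle (𝓡 (m + 1)) Q)) q)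
    (hY : MDifferentiableAt (𝓡 (m + 1)) (𝓡 (m + 1)).tangent
      (fun p => (⟨p, Y p⟩ : TangentBundle (𝓡 (m + 1)) Q)) q) :
    velocity φ q (VectorField.mlieBracket (𝓡 (m + 1)) X Y q) =
      (show Coord m from
        mfderiv (𝓡 (m + 1)) 𝓘(ℝ, Coord m) (fun p => velocity φ p (Y p)) q (X q)) -
      (show Coord m from
        mfderiv (𝓡 (m + 1)) 𝓘(ℝ, Coord m) (fun p => velocity φ p (X p)) q (Y q)) := by
  have : IsManifold (𝓡 (m + 1)) (minSmoothness ℝ 2) Q := by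
    rw [minSmoothness_of_isRCLikeNormedField]
    exact IsManifold.of_le (n := ∞) (by norm_cast)
  have hx := φ.map_source hq
  have hev : ∀ W : ∀ p : Q, TangentSpace (𝓡 (m + 1)) p,
      VectorField.mpullback (𝓡 (m + 1)) (𝓡 (m + 1)) φ.symm W =ᶠ[𝓝 (φ q)]
        (fun p => velocity φ p (W p)) ∘ φ.symm := fun W => by
    filter_upwards [φ.open_target.mem_nhds hx] with x hx
    exact mpullback_chart_symm hφ hx
  have h := VectorField.mpullback_mlieBracket (I := 𝓡 (m + 1)) (I' := 𝓡 (m + 1)) (n := ∞)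
    (f := φ.symm) (V := X) (W := Y) (x₀ := φ q) (by rwa [φ.left_inv hq]) (by rwa [φ.left_inv hq])
    (contMDiffAt_symm_of_mem_maximalAtlas hφ hx) (by simp; norm_cast)
  rw [mpullback_chart_symm hφ hx, (hev X).mlieBracket_vectorField_eq (hev Y)] at h
  replace h := h.trans (mlieBracket_coord _ _ (φ q))
  rw [mfderiv_eq_fderiv_comp_symm hφ hq (mdifferentiableAt_velocity_comp hφ hY hq),
    mfderiv_eq_fderiv_comp_symm hφ hq (mdifferentiableAt_velocity_comp hφ hX hq)]
  -- `h` lives at `φ.symm (φ q)`. The tangent space depends on the point, so the equality with `q`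
  -- is applied by substituting a variable.
  have hsubst : ∀ p, p = q → ∀ A B : Coord m →L[ℝ] Coord m,
      velocity φ p (VectorField.mlieBracket (𝓡 (m + 1)) X Y p) =
        A (velocity φ p (X p)) - B (velocity φ p (Y p)) →
      velocity φ q (VectorField.mlieBracket (𝓡 (m + 1)) X Y q) =
        A (velocity φ q (X q)) - B (velocity φ q (Y q)) := by
    rintro _ rfl A B h
    exact h
  exact hsubst _ (φ.left_inv hq) _ _ h

/-- Smoothness of a finite order at a point spreads to a neighbourhood; order one suffices. -/
theorem eventually_mdifferentiableAt_section
    (hZ : ContMDiffAt (𝓡 (m + 1)) (𝓡 (m + 1)).tangent ∞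
      (fun p => (⟨p, Z p⟩ : TangentBundle (𝓡 (m + 1)) Q)) q) :
    ∀ᶠ p in 𝓝 q, MDifferentiableAt (𝓡 (m + 1)) (𝓡 (m + 1)).tangent
      (fun p => (⟨p, Z p⟩ : TangentBundle (𝓡 (m + 1)) Q)) p := by
  filter_upwards [(contMDiffAt_iff_contMDiffAt_nhds (by simp)).mp
    (hZ.of_le (show (1 : ℕ∞ω) ≤ ∞ by norm_cast))] with p hp
  exact hp.mdifferentiableAt (by simp)

theorem contMDiffAt_flatConnection (hξ : ξ.IsFreeMotion)
    (hZ : ContMDiffAt (𝓡 (m + 1)) (𝓡 (m + 1)).tangent ∞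
      (fun p => (⟨p, Z p⟩ : TangentBundle (𝓡 (m + 1)) Q)) q) :
    ContMDiffAt (𝓡 (m + 1)) ((𝓡 (m + 1)).prod 𝓘(ℝ, Coord m →L[ℝ] Coord m)) ∞
      (fun p => (⟨p, flatConnection hξ Z p⟩ : Bundle.TotalSpace (Coord m →L[ℝ] Coord m)
        fun p : Q => TangentSpace (𝓡 (m + 1)) p →L[ℝ] TangentSpace (𝓡 (m + 1)) p)) q := by
  rw [contMDiffAt_hom_bundle]
  refine ⟨contMDiffAt_id, ?_⟩
  have hψ := isFreeChart_freeChart hξ q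
  have hq := mem_freeChart_source hξ q
  set ψ := freeChart hξ q
  have hm := hψ.isBundleChart.mem_maximalAtlas
  -- This chart defines the trivialization of `TQ` at `q` and need not be a bundle chart. The
  -- connection is computed in the free chart `ψ` and carried to `φ`, where it is the composite of
  -- two smooth families of linear maps.
  set φ := chartAt (Coord m) q with hφdef
  have hφ : φ ∈ IsManifold.maximalAtlas (𝓡 (m + 1)) ∞ Q := IsManifold.chart_mem_maximalAtlas q
  have hqφ : q ∈ φ.source := mem_chart_source _ q
  set ζ : Q → Coord m := fun p => velocity ψ p (Z p)
  have hζ : ContMDiffAt (𝓡 (m + 1)) 𝓘(ℝ, Coord m) ∞ ζ q := (contMDiffAt_velocity hm hq).comp q hZ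
  have h1 : ContDiffAt ℝ ∞ (fderiv ℝ (transition ψ φ)) (ψ q) :=
    (contDiffAt_transition hm hφ hq hqφ).fderiv_right (m := ∞) (by simp)
  have h2 : ContDiffAt ℝ ∞ (fderiv ℝ (ζ ∘ φ.symm)) (φ q) :=
    (contDiffAt_comp_symm hφ hqφ hζ).fderiv_right (m := ∞) (by simp)
  have hψs : ContMDiffAt (𝓡 (m + 1)) 𝓘(ℝ, Coord m) ∞ ψ q := contMDiffAt_of_mem_maximalAtlas hm hq
  have hφs : ContMDiffAt (𝓡 (m + 1)) 𝓘(ℝ, Coord m) ∞ φ q := contMDiffAt_of_mem_maximalAtlas hφ hqφ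
  refine ((h1.contMDiffAt.comp q hψs).clm_comp (h2.contMDiffAt.comp q hφs)).congr_of_eventuallyEq ?_
  filter_upwards [φ.open_source.mem_nhds hqφ, ψ.open_source.mem_nhds hq,
    eventually_mdifferentiableAt_section hZ] with p hpφ hpψ hZp
  ext1 u
  set w : TangentSpace (𝓡 (m + 1)) p :=
    (trivializationAt (Coord m) (TangentSpace (𝓡 (m + 1))) q).symmL ℝ p u with hw
  have htriv : ∀ v : TangentSpace (𝓡 (m + 1)) p,
      (trivializationAt (Coord m) (TangentSpace (𝓡 (m + 1))) q).continuousLinearMapAt ℝ p v =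
        velocity φ p v := fun v => by
    rw [TangentBundle.continuousLinearMapAt_trivializationAt hpφ]
    rfl
  have hwu : velocity φ p w = u := by
    rw [← htriv, hw]
    exact Bundle.Trivialization.continuousLinearMapAt_symmL _ (by simpa using hpφ) u
  change (trivializationAt (Coord m) (TangentSpace (𝓡 (m + 1))) q).continuousLinearMapAt ℝ p
    (flatConnection hξ Z p w) = fderiv ℝ (transition ψ φ) (ψ p) (fderiv ℝ (ζ ∘ φ.symm) (φ p) u)
  rw [htriv, velocity_transition hm hφ hpψ hpφ, velocity_flatConnection hξ hψ hpψ hZp,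
    mfderiv_eq_fderiv_comp_symm hφ hpφ (mdifferentiableAt_velocity_comp hm hZp hpψ), hwu]

theorem contMDiffCovariantDerivative_flatConnection (hξ : ξ.IsFreeMotion) :
    CovariantDerivative.ContMDiffCovariantDerivative (flatConnection hξ) ∞ :=
  ⟨⟨fun hσ q _ => (contMDiffAt_flatConnection hξ
    ((hσ.of_le (by simp)).contMDiffAt Filter.univ_mem)).contMDiffWithinAt⟩⟩

theorem contMDiffAt_flatConnection_apply (hξ : ξ.IsFreeMotion)
    (hZ : ContMDiffAt (𝓡 (m + 1)) (𝓡 (m + 1)).tangent ∞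
      (fun p => (⟨p, Z p⟩ : TangentBundle (𝓡 (m + 1)) Q)) q)
    (hY : ContMDiffAt (𝓡 (m + 1)) (𝓡 (m + 1)).tangent ∞
      (fun p => (⟨p, Y p⟩ : TangentBundle (𝓡 (m + 1)) Q)) q) :
    ContMDiffAt (𝓡 (m + 1)) (𝓡 (m + 1)).tangent ∞
      (fun p => (⟨p, flatConnection hξ Z p (Y p)⟩ : TangentBundle (𝓡 (m + 1)) Q)) q :=
  ContMDiffAt.clm_bundle_apply (contMDiffAt_flatConnection hξ hZ) hY

/-- In a free chart `∇_X Y - ∇_Y X` is literally the coordinate expression of `[X, Y]`. -/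
theorem torsion_flatConnection (hξ : ξ.IsFreeMotion) :
    CovariantDerivative.torsion (flatConnection hξ) = 0 := by
  rw [CovariantDerivative.torsion_eq_zero_iff]
  intro X Y q hX hY
  have hψ := isFreeChart_freeChart hξ q
  have hq := mem_freeChart_source hξ q
  have hm := hψ.isBundleChart.mem_maximalAtlas
  refine velocity_injective hm hq ?_
  rw [velocity_mlieBracket hm hq hX hY, ← velocityEquiv_apply hm hq, map_sub, velocityEquiv_apply,
    velocityEquiv_apply, velocity_flatConnection hξ hψ hq hX, velocity_flatConnection hξ hψ hq hY]

/-- In a free chart, with `z` the components of `Z`, the inner derivative is `Dz(Y)` near `q`; the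
product rule then gives `D²z(v, Y) + Dz(DY(v))`. -/
theorem mfderiv_velocity_flatConnection (hξ : ξ.IsFreeMotion) (hψ : ξ.IsFreeChart ψ)
    (hq : q ∈ ψ.source)
    (hY : ContMDiffAt (𝓡 (m + 1)) (𝓡 (m + 1)).tangent ∞
      (fun p => (⟨p, Y p⟩ : TangentBundle (𝓡 (m + 1)) Q)) q)
    (hZ : ContMDiffAt (𝓡 (m + 1)) (𝓡 (m + 1)).tangent ∞
      (fun p => (⟨p, Z p⟩ : TangentBundle (𝓡 (m + 1)) Q)) q) (v : TangentSpace (𝓡 (m + 1)) q) :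
    velocity ψ q (flatConnection hξ (fun p => flatConnection hξ Z p (Y p)) q v) =
      fderiv ℝ (fderiv ℝ ((fun p => velocity ψ p (Z p)) ∘ ψ.symm)) (ψ q) (velocity ψ q v)
          (velocity ψ q (Y q)) +
        fderiv ℝ ((fun p => velocity ψ p (Z p)) ∘ ψ.symm) (ψ q)
          (mfderiv (𝓡 (m + 1)) 𝓘(ℝ, Coord m) (fun p => velocity ψ p (Y p)) q v) := by
  have hm := hψ.isBundleChart.mem_maximalAtlas
  rw [velocity_flatConnection hξ hψ hq
    ((contMDiffAt_flatConnection_apply hξ hZ hY).mdifferentiableAt (by simp))]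
  have hev : (fun p => velocity ψ p (flatConnection hξ Z p (Y p))) =ᶠ[𝓝 q] fun p =>
      fderiv ℝ ((fun p => velocity ψ p (Z p)) ∘ ψ.symm) (ψ p) (velocity ψ p (Y p)) := by
    filter_upwards [ψ.open_source.mem_nhds hq,
      eventually_mdifferentiableAt_section hZ] with p hp hZp
    rw [velocity_flatConnection hξ hψ hp hZp,
      mfderiv_eq_fderiv_comp_symm hm hp (mdifferentiableAt_velocity_comp hm hZp hp)]
  have h := mfderiv_fderiv_velocity hm (hY.mdifferentiableAt (by simp)) hq
    (contDiffAt_comp_symm hm hq ((contMDiffAt_velocity hm hq).comp q hZ)) v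
  have hid : mfderiv (𝓡 (m + 1)) (𝓡 (m + 1)) (fun p : Q => p) q v = v :=
    congrArg (fun L : TangentSpace (𝓡 (m + 1)) q →L[ℝ] TangentSpace (𝓡 (m + 1)) q => L v)
      (mfderiv_id (I := 𝓡 (m + 1)) (x := q))
  refine (congrArg (fun L : TangentSpace (𝓡 (m + 1)) q →L[ℝ] Coord m => L v)
    hev.mfderiv_eq).trans (h.trans ?_)
  change fderiv ℝ (fderiv ℝ ((fun p => velocity ψ p (Z p)) ∘ ψ.symm)) (ψ q)
    (velocity ψ q (mfderiv (𝓡 (m + 1)) (𝓡 (m + 1)) (fun p : Q => p) q v)) _ + _ = _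
  rw [hid]
  rfl

theorem isCurvatureFree_flatConnection (hξ : ξ.IsFreeMotion) :
    LinearConnection.IsCurvatureFree (flatConnection hξ) := by
  intro q X Y Z hX hY hZ
  have hψ := isFreeChart_freeChart hξ q
  have hq := mem_freeChart_source hξ q
  set ψ := freeChart hξ q
  have hm := hψ.isBundleChart.mem_maximalAtlas
  have hXd := hX.mdifferentiableAt (by simp)
  have hYd := hY.mdifferentiableAt (by simp)
  have hZd := hZ.mdifferentiableAt (by simp)
  refine (velocityEquiv hm hq).injective ?_
  rw [LinearConnection.curvature, map_sub, map_sub, map_zero]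
  simp only [velocityEquiv_apply]
  rw [mfderiv_velocity_flatConnection hξ hψ hq hY hZ,
    mfderiv_velocity_flatConnection hξ hψ hq hX hZ, velocity_flatConnection hξ hψ hq hZd,
    mfderiv_eq_fderiv_comp_symm hm hq (mdifferentiableAt_velocity_comp hm hZd hq),
    velocity_mlieBracket hm hq hXd hYd, map_sub]
  have hsymm := ((contDiffAt_comp_symm hm hq ((contMDiffAt_velocity hm hq).comp q
    hZ)).isSymmSndFDerivAt (by simp; norm_cast)).eq (velocity ψ q (X q)) (velocity ψ q (Y q))
  -- Here `a`, `a'` are the second derivatives of the components of `Z` in the two orders, and `b`,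
  -- `c` come from differentiating `Y` along `X` and `X` along `Y`; the bracket term cancels `b -
  -- c`.
  have hcancel : ∀ a a' b c : Coord m, a = a' → a + b - (a' + c) - (b - c) = 0 := by
    rintro a _ b c rfl
    abel
  exact hcancel _ _ _ _ hsymm

end Curvature

end TimeMechanics

end

theorem proposition6p2 {m : ℕ}
    {M : Type*} [TopologicalSpace M] [T2Space M] [SecondCountableTopology M]
    [ChartedSpace (EuclideanSpace ℝ (Fin m)) M] [IsManifold (𝓡 m) ∞ M]
    {Q : Type*} [TopologicalSpace Q] [T2Space Q] [SecondCountableTopology Q]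
    [ChartedSpace (EuclideanSpace ℝ (Fin (m + 1))) Q] [IsManifold (𝓡 (m + 1)) ∞ Q]
    (π : Q → ℝ) (hπ : TimeMechanics.IsSmoothFibreBundle m M π)
    (ξ : TimeMechanics.DynamicEquation m π) (hξ : ξ.IsFreeMotion) :
    ξ.IsQuadratic ∧
    ∃ K : TimeMechanics.LinearConnection m Q,
      CovariantDerivative.ContMDiffCovariantDerivative K ∞ ∧
      K.CorrespondsTo ξ ∧
      (∀ K' : TimeMechanics.LinearConnection m Q, K'.CorrespondsTo ξ → K'.SameAs K) ∧
      K.torsion = 0 ∧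
      K.IsCurvatureFree :=
  ⟨fun _ hφ => ⟨_, _, _, TimeMechanics.hasQuadraticForm_connectionCoefficients hξ hφ⟩,
    TimeMechanics.flatConnection hξ,
    TimeMechanics.contMDiffCovariantDerivative_flatConnection hξ,
    TimeMechanics.correspondsTo_flatConnection hξ,
    TimeMechanics.sameAs_flatConnection hξ,
    TimeMechanics.torsion_flatConnection hξ,
    TimeMechanics.isCurvatureFree_flatConnection hξ⟩
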